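/- A partially ordered group is a (not necessarily commutative) group $G$ with a partial order such that $a\le b$ implies $sat\le sbt$ for all $a,b,s,t\in G$; an $\ell$-group is a partially ordered group whose order is a lattice order. An $\ell$-group is representable if it is a subdirect product of totally ordered groups, and Abelian if its underlying group is Abelian. Let $\mathsf V$ be the variety of all $\ell$-groups, or of representable $\ell$-groups, or of Abelian $\ell$-groups. For a partially ordered group $G$ let $\eta\colon G\to F_{\mathsf V}(G)$ be the free $\ell$-group over $G$ in $\mathsf V$: $F_{\mathsf V}(G)\in\mathsf V$, $\eta$ is an order-preserving group homomorphism, and each order-preserving group homomorphism $p\colon G\to H$ with $H\in\mathsf V$ is of the form $p=h\circ\eta$ for exactly one $\ell$-homomorphism (group and lattice homomorphism) $h\colon F_{\mathsf V}(G)\to H$. For an $\ell$-group $H$, a prime subgroup is a proper subgroup $\mathfrak p\subsetneq H$ that is a sublattice of $H$ and order convex, and whose cosets are totally ordered by: $\mathfrak p x\le\mathfrak p y$ if and only if $x\le ty$ for some $t\in\mathfrak p$. Let $\operatorname{Spec}H$ be the set of prime subgroups, with the topology whose open sets are the sets $\{\mathfrak p\in\operatorname{Spec}H\mid A\not\subseteq\mathfrak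 p\}$ for arbitrary subsets $A\subseteq H$, and let $\operatorname{Min}H\subseteq\operatorname{Spec}H$ be the subspace of the inclusion-minimal prime subgroups. Theorem. Let $\mathsf V$ be the variety of all, of representable, or of Abelian $\ell$-groups. For every partially ordered group $G$, the minimal spectrum $\operatorname{Min}F_{\mathsf V}(G)$ is compact. -/

import Mathlib

universe u v w

namespace LGrp

/-! A partially ordered group is a group `G` with a partial order such that left and right
translations are monotone: `[Group G] [PartialOrder G] [MulLeftMono G] [MulRightMono G]`.
A lattice-ordered group is the same with `[Lattice H]` in place of `[PartialOrder H]`.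
Groups are written multiplicatively and need not be commutative. -/

/-- `f` is an ℓ-homomorphism: a group homomorphism that preserves binary joins and meets. -/
structure IsLHom {H : Type u} {K : Type v} [Group H] [Lattice H] [Group K] [Lattice K]
    (f : H →* K) : Prop where
  map_sup : ∀ x y, f (x ⊔ y) = f x ⊔ f y
  map_inf : ∀ x y, f (x ⊓ y) = f x ⊓ f y

/-- An ℓ-group is representable if it is (isomorphic to) a subdirect product of totally ordered
groups: it admits a jointly injective family of surjective ℓ-homomorphisms onto totally ordered
groups. -/
def IsRepresentable (H : Type u) [Group H] [Lattice H] : Prop :=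
  ∃ (ι : Type u) (T : ι → Type u) (_ : ∀ i, Group (T i)) (_ : ∀ i, LinearOrder (T i))
    (_ : ∀ i, MulLeftMono (T i)) (_ : ∀ i, MulRightMono (T i)) (f : ∀ i, H →* T i),
    (∀ i, IsLHom (f i)) ∧ (∀ i, Function.Surjective (f i)) ∧
      ∀ x y, (∀ i, f i x = f i y) → x = y

/-- An ℓ-group is Abelian if its underlying group is. -/
def IsAbelian (H : Type u) [Group H] : Prop := ∀ x y : H, x * y = y * x

/-- The three varieties of ℓ-groups under consideration. -/
inductive Variety : Type
  | all
  | representable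
  | abelian

/-- Membership of an ℓ-group in the variety `V`. -/
def Variety.Mem (V : Variety) (H : Type u) [Group H] [Lattice H] : Prop :=
  match V with
  | .all => True
  | .representable => IsRepresentable H
  | .abelian => IsAbelian H

/-- The universal property of the free ℓ-group over the partially ordered group `G` in `V`:
`F` lies in `V`, `η : G → F` is a positive homomorphism, and every positive homomorphism from `G`
to an ℓ-group in `V` factors through `η` by exactly one ℓ-homomorphism. -/
structure IsFreeOver (V : Variety) {G F : Type u} [Group G] [PartialOrder G]
    [Group F] [Lattice F] (η : G →* F) : Prop where
  mem : V.Mem F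
  mono : Monotone η
  lift : ∀ (H : Type u) [Group H] [Lattice H] [MulLeftMono H] [MulRightMono H], V.Mem H →
    ∀ p : G →* H, Monotone p → ∃! h : F →* H, IsLHom h ∧ h.comp η = p

/-! ### Construction of the free ℓ-group -/

/-- Formal ℓ-group terms with generators the elements of `G`. -/
inductive Term (G : Type u) : Type u
  | of : G → Term G
  | one : Term G
  | mul : Term G → Term G → Term G
  | inv : Term G → Term G
  | sup : Term G → Term G → Term G
  | inf : Term G → Term G → Term G

/-- The value of a term under an assignment of the generators. -/
def Term.eval {G : Type u} {H : Type v} [Group H] [Lattice H] (p : G → H) : Term G → H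
  | .of g => p g
  | .one => 1
  | .mul s t => s.eval p * t.eval p
  | .inv s => (s.eval p)⁻¹
  | .sup s t => s.eval p ⊔ t.eval p
  | .inf s t => s.eval p ⊓ t.eval p

section Free

variable (V : Variety) (G : Type u) [Group G] [PartialOrder G]

/-- Two terms are identified when every positive homomorphism from `G` to an ℓ-group in `V` gives
them the same value. -/
def termSetoid : Setoid (Term G) where
  r s t := ∀ (H : Type u) [Group H] [Lattice H] [MulLeftMono H] [MulRightMono H], V.Mem H →
    ∀ p : G →* H, Monotone p → s.eval p = t.eval p
  iseqv :=
    { refl := fun _ _ _ _ _ _ _ _ _ => rfl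
      symm := fun h H _ _ _ _ hV p hp => (h H hV p hp).symm
      trans := fun h k H _ _ _ _ hV p hp => (h H hV p hp).trans (k H hV p hp) }

/-- The free ℓ-group over the partially ordered group `G` in the variety `V`. -/
def FreeLGroup : Type u := Quotient (termSetoid V G)

namespace FreeLGroup

instance : One (FreeLGroup V G) := ⟨Quotient.mk _ .one⟩

instance : Mul (FreeLGroup V G) := ⟨Quotient.map₂ .mul fun _ _ h _ _ k H _ _ _ _ hV p hp => by
  simp only [Term.eval]; rw [h H hV p hp, k H hV p hp]⟩

instance : Inv (FreeLGroup V G) := ⟨Quotient.map .inv fun _ _ h H _ _ _ _ hV p hp => by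
  simp only [Term.eval]; rw [h H hV p hp]⟩

instance : Max (FreeLGroup V G) := ⟨Quotient.map₂ .sup fun _ _ h _ _ k H _ _ _ _ hV p hp => by
  simp only [Term.eval]; rw [h H hV p hp, k H hV p hp]⟩

instance : Min (FreeLGroup V G) := ⟨Quotient.map₂ .inf fun _ _ h _ _ k H _ _ _ _ hV p hp => by
  simp only [Term.eval]; rw [h H hV p hp, k H hV p hp]⟩

instance : Group (FreeLGroup V G) :=
  Group.ofLeftAxioms
    (by
      rintro ⟨a⟩ ⟨b⟩ ⟨c⟩
      exact Quotient.sound fun H _ _ _ _ _ p _ => by simp only [Term.eval, mul_assoc])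
    (by
      rintro ⟨a⟩
      exact Quotient.sound fun H _ _ _ _ _ p _ => by simp only [Term.eval, one_mul])
    (by
      rintro ⟨a⟩
      exact Quotient.sound fun H _ _ _ _ _ p _ => by simp only [Term.eval, inv_mul_cancel])

/-- The order is the one of the lattice operations: `x ≤ y` if and only if `x ⊔ y = y`. -/
instance : Lattice (FreeLGroup V G) :=
  Lattice.mk'
    (by
      rintro ⟨a⟩ ⟨b⟩
      exact Quotient.sound fun H _ _ _ _ _ p _ => by simp only [Term.eval, sup_comm])
    (by
      rintro ⟨a⟩ ⟨b⟩ ⟨c⟩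
      exact Quotient.sound fun H _ _ _ _ _ p _ => by simp only [Term.eval, sup_assoc])
    (by
      rintro ⟨a⟩ ⟨b⟩
      exact Quotient.sound fun H _ _ _ _ _ p _ => by simp only [Term.eval, inf_comm])
    (by
      rintro ⟨a⟩ ⟨b⟩ ⟨c⟩
      exact Quotient.sound fun H _ _ _ _ _ p _ => by simp only [Term.eval, inf_assoc])
    (by
      rintro ⟨a⟩ ⟨b⟩
      exact Quotient.sound fun H _ _ _ _ _ p _ => by simp only [Term.eval, sup_inf_self])
    (by
      rintro ⟨a⟩ ⟨b⟩
      exact Quotient.sound fun H _ _ _ _ _ p _ => by simp only [Term.eval, inf_sup_self])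

instance : MulLeftMono (FreeLGroup V G) := ⟨by
  rintro ⟨c⟩ ⟨a⟩ ⟨b⟩ h
  refine sup_eq_right.mp (Quotient.sound fun H _ _ _ _ hV p hp => ?_)
  have h' := Quotient.exact (sup_eq_right.mpr h) H hV p hp
  simp only [Term.eval] at h' ⊢
  rw [← mul_sup, h']⟩

instance : MulRightMono (FreeLGroup V G) := ⟨by
  rintro ⟨c⟩ ⟨a⟩ ⟨b⟩ h
  refine sup_eq_right.mp (Quotient.sound fun H _ _ _ _ hV p hp => ?_)
  have h' := Quotient.exact (sup_eq_right.mpr h) H hV p hp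
  simp only [Term.eval] at h' ⊢
  rw [← sup_mul, h']⟩

/-- The universal map `G → FreeLGroup V G`. -/
def η : G →* FreeLGroup V G where
  toFun g := Quotient.mk _ (.of g)
  map_one' := Quotient.sound fun H _ _ _ _ _ p _ => by simp only [Term.eval, map_one]
  map_mul' a b := Quotient.sound fun H _ _ _ _ _ p _ => by simp only [Term.eval, map_mul]

variable {V G}

/-- The ℓ-homomorphism induced by a positive homomorphism `p : G → H`. -/
def lift {H : Type u} [Group H] [Lattice H] [MulLeftMono H] [MulRightMono H] (hV : V.Mem H)
    (p : G →* H) (hp : Monotone p) : FreeLGroup V G →* H where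
  toFun := Quotient.lift (Term.eval p) fun _ _ h => h H hV p hp
  map_one' := rfl
  map_mul' := by rintro ⟨a⟩ ⟨b⟩; rfl

theorem lift_isLHom {H : Type u} [Group H] [Lattice H] [MulLeftMono H] [MulRightMono H]
    (hV : V.Mem H) (p : G →* H) (hp : Monotone p) : IsLHom (lift hV p hp) where
  map_sup := by rintro ⟨a⟩ ⟨b⟩; rfl
  map_inf := by rintro ⟨a⟩ ⟨b⟩; rfl

theorem exists_lift_ne {x y : FreeLGroup V G} (hxy : x ≠ y) :
    ∃ (H : Type u) (_ : Group H) (_ : Lattice H) (_ : MulLeftMono H) (_ : MulRightMono H)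
      (hV : V.Mem H) (p : G →* H) (hp : Monotone p), lift hV p hp x ≠ lift hV p hp y := by
  obtain ⟨s⟩ := x
  obtain ⟨t⟩ := y
  by_contra! hcon
  exact hxy (Quotient.sound fun H iG iL iM iN hV p hp =>
    hcon H iG iL iM iN hV p hp)

theorem exists_chain_ne {x y : FreeLGroup Variety.representable G} (hxy : x ≠ y) :
    ∃ (T : Type u) (_ : Group T) (_ : LinearOrder T) (_ : MulLeftMono T) (_ : MulRightMono T)
      (f : FreeLGroup Variety.representable G →* T),
      IsLHom f ∧ Function.Surjective f ∧ f x ≠ f y := by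
  obtain ⟨H, _, _, _, _, hV, p, hp, hne⟩ := exists_lift_ne hxy
  obtain ⟨ι, T, _, _, _, _, f, hf, -, hinj⟩ := id hV
  have hex : ∃ i, f i (lift hV p hp x) ≠ f i (lift hV p hp y) := by
    by_contra! hcon
    exact hne (hinj _ _ hcon)
  obtain ⟨i, hi⟩ := hex
  let k : FreeLGroup Variety.representable G →* T i := (f i).comp (lift hV p hp)
  have hk : IsLHom k :=
    ⟨fun a b => by simp [k, (lift_isLHom hV p hp).map_sup, (hf i).map_sup],
      fun a b => by simp [k, (lift_isLHom hV p hp).map_inf, (hf i).map_inf]⟩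
  refine ⟨k.range, inferInstance, inferInstance, ⟨?_⟩, ⟨?_⟩, k.rangeRestrict, ⟨?_, ?_⟩,
    k.rangeRestrict_surjective, ?_⟩
  · intro c a b h
    exact mul_le_mul_right (show (a : T i) ≤ b from h) (c : T i)
  · intro c a b h
    exact mul_le_mul_left (show (a : T i) ≤ b from h) (c : T i)
  · intro a b
    apply Subtype.ext
    rw [(Subtype.mono_coe (· ∈ k.range)).map_sup]
    exact hk.map_sup a b
  · intro a b
    apply Subtype.ext
    rw [(Subtype.mono_coe (· ∈ k.range)).map_inf]
    exact hk.map_inf a b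
  · intro h
    exact hi (congrArg Subtype.val h)

theorem mem_variety : V.Mem (FreeLGroup V G) := by
  cases V with
  | all => trivial
  | representable =>
    have key := fun q : {q : FreeLGroup Variety.representable G ×
      FreeLGroup Variety.representable G // q.1 ≠ q.2} => exists_chain_ne q.2
    choose T i1 i2 i3 i4 f h1 h2 h3 using key
    refine ⟨_, T, i1, i2, i3, i4, f, h1, h2, fun x y hxy => ?_⟩
    by_contra hne
    exact h3 ⟨(x, y), hne⟩ (hxy _)
  | abelian =>
    rintro ⟨a⟩ ⟨b⟩
    exact Quotient.sound fun H _ _ _ _ hV p hp => hV _ _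

/-- `FreeLGroup V G`, with the map `η`, has the universal property of the free ℓ-group. -/
theorem isFreeOver : IsFreeOver V (η V G) where
  mem := mem_variety
  mono := by
    intro a b hab
    refine sup_eq_right.mp (Quotient.sound fun H _ _ _ _ hV p hp => ?_)
    simpa only [Term.eval, sup_eq_right] using hp hab
  lift := by
    intro H _ _ _ _ hV p hp
    refine ⟨lift hV p hp, ⟨lift_isLHom hV p hp, rfl⟩, ?_⟩
    rintro h ⟨hh, hc⟩
    have key : ∀ t : Term G, h (Quotient.mk _ t) = t.eval p := by
      intro t
      induction t with
      | of g => exact DFunLike.congr_fun hc g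
      | one => exact map_one h
      | mul s t hs ht => exact (map_mul h _ _).trans (congrArg₂ _ hs ht)
      | inv s hs => exact (map_inv h _).trans (congrArg _ hs)
      | sup s t hs ht => exact (hh.map_sup _ _).trans (congrArg₂ _ hs ht)
      | inf s t hs ht => exact (hh.map_inf _ _).trans (congrArg₂ _ hs ht)
    ext ⟨t⟩
    exact key t

end FreeLGroup

end Free

/-! ### Spectra -/

section Spectrum

variable {H : Type u} [Group H] [Lattice H]

/-- A convex ℓ-subgroup: an order convex sublattice subgroup. -/
structure IsConvexLSubgroup (K : Subgroup H) : Prop where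
  sup_mem : ∀ {x y}, x ∈ K → y ∈ K → x ⊔ y ∈ K
  inf_mem : ∀ {x y}, x ∈ K → y ∈ K → x ⊓ y ∈ K
  convex : ∀ {x y z}, x ∈ K → z ∈ K → x ≤ y → y ≤ z → y ∈ K

/-- The order of the cosets `K x` and `K y`: `K x ≤ K y` iff `x ≤ t y` for some `t ∈ K`. -/
def CosetLE (K : Subgroup H) (x y : H) : Prop := ∃ t ∈ K, x ≤ t * y

/-- A prime subgroup: a proper convex ℓ-subgroup whose cosets are totally ordered. -/
structure IsPrimeSubgroup (K : Subgroup H) : Prop extends IsConvexLSubgroup K where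
  proper : K ≠ ⊤
  total : ∀ x y, CosetLE K x y ∨ CosetLE K y x

variable (H)

/-- The set of prime subgroups of `H`. -/
def Spec : Type u := {K : Subgroup H // IsPrimeSubgroup K}

variable {H}

/-- Prime subgroups are ordered by inclusion. -/
instance : PartialOrder (Spec H) := PartialOrder.lift (fun 𝔭 : Spec H => 𝔭.1) Subtype.val_injective

/-- The set of prime subgroups that do not include `A`. -/
def Spec.supp (A : Set H) : Set (Spec H) := {𝔭 | ¬ A ⊆ (𝔭.1 : Set H)}

variable [MulLeftMono H] [MulRightMono H]

theorem IsConvexLSubgroup.mabs_mem_iff {K : Subgroup H} (hK : IsConvexLSubgroup K) {x : H} :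
    |x|ₘ ∈ K ↔ x ∈ K := by
  refine ⟨fun h => hK.convex (K.inv_mem h) h ?_ (le_mabs_self x),
    fun h => hK.sup_mem h (K.inv_mem h)⟩
  exact inv_le_of_inv_le' (inv_le_mabs x)

theorem IsPrimeSubgroup.inf_mabs_mem_iff {K : Subgroup H} (hK : IsPrimeSubgroup K) {x y : H} :
    |x|ₘ ⊓ |y|ₘ ∈ K ↔ x ∈ K ∨ y ∈ K := by
  have aux : ∀ a b : H, |a|ₘ ⊓ |b|ₘ ∈ K → CosetLE K |a|ₘ |b|ₘ → a ∈ K := by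
    rintro a b hab ⟨t, ht, hle⟩
    refine hK.mabs_mem_iff.mp
      (hK.convex K.one_mem (K.mul_mem (hK.sup_mem ht K.one_mem) hab) (one_le_mabs a) ?_)
    rw [mul_inf]
    refine le_inf ?_ (hle.trans (mul_le_mul_left le_sup_left _))
    exact le_mul_of_one_le_left' le_sup_right
  constructor
  · intro h
    rcases hK.total |x|ₘ |y|ₘ with hxy | hyx
    · exact Or.inl (aux x y h hxy)
    · exact Or.inr (aux y x (by rwa [inf_comm]) hyx)
  · have h1 : (1 : H) ≤ |x|ₘ ⊓ |y|ₘ := le_inf (one_le_mabs x) (one_le_mabs y)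
    rintro (h | h)
    · exact hK.convex K.one_mem (hK.mabs_mem_iff.mpr h) h1 inf_le_left
    · exact hK.convex K.one_mem (hK.mabs_mem_iff.mpr h) h1 inf_le_right

/-- The spectral (Zariski) topology: the open sets are exactly the sets `Spec.supp A`, for
arbitrary subsets `A` of `H`. -/
instance : TopologicalSpace (Spec H) where
  IsOpen U := ∃ A : Set H, U = Spec.supp A
  isOpen_univ := ⟨Set.univ, by
    symm
    rw [Set.eq_univ_iff_forall]
    intro 𝔭 h
    exact 𝔭.2.proper (top_le_iff.mp fun x _ => h (Set.mem_univ x))⟩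
  isOpen_inter := by
    rintro _ _ ⟨A, rfl⟩ ⟨B, rfl⟩
    refine ⟨{z | ∃ a ∈ A, ∃ b ∈ B, z = |a|ₘ ⊓ |b|ₘ}, ?_⟩
    ext 𝔭
    simp only [Spec.supp, Set.mem_inter_iff, Set.mem_ofPred_eq, Set.not_subset, SetLike.mem_coe]
    constructor
    · rintro ⟨⟨a, ha, ha'⟩, b, hb, hb'⟩
      refine ⟨_, ⟨a, ha, b, hb, rfl⟩, fun h => ?_⟩
      rcases 𝔭.2.inf_mabs_mem_iff.mp h with h | h
      · exact ha' h
      · exact hb' h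
    · rintro ⟨_, ⟨a, ha, b, hb, rfl⟩, h⟩
      rw [𝔭.2.inf_mabs_mem_iff, not_or] at h
      exact ⟨⟨a, ha, h.1⟩, b, hb, h.2⟩
  isOpen_sUnion := by
    intro S hS
    refine ⟨⋃₀ {A | Spec.supp A ∈ S}, ?_⟩
    ext 𝔭
    constructor
    · rintro ⟨U, hU, hp⟩
      obtain ⟨A, rfl⟩ := hS U hU
      exact fun h => hp fun a ha => h ⟨A, hU, ha⟩
    · intro h
      obtain ⟨a, ⟨A, hA, ha⟩, hap⟩ := Set.not_subset.mp h
      exact ⟨_, hA, fun h' => hap (h' ha)⟩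

variable (H)

/-- The minimal spectrum: the inclusion-minimal prime subgroups, with the subspace topology. -/
abbrev MinSpec : Type u := {𝔭 : Spec H // IsMin 𝔭}

end Spectrum

end LGrp

set_option linter.unusedSectionVars false

namespace LGrp

/-! ### Convex ℓ-subgroups with totally ordered cosets, and their ultralimits -/

section TotalSubgroups

variable {H : Type u} [Group H] [Lattice H] [MulLeftMono H] [MulRightMono H]

/-! The minimal primes of the free ℓ-group F over G are exactly the primes that contain no η(g) ≠ 1
(`FreeLGroup.isMin_iff`). Omitting each such η(g) is a condition that survives limits along
ultrafilters, as do convexity and totality of the cosets (`ultralimit`). Hence each ultrafilter on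
Min F has its ultralimit as a minimal prime, and it converges to that point.

One half of the criterion: F acts on the chain of cosets of a prime 𝔮, and in a chain a join or meet
is one of its two arguments, so every coset has a representative η(g) (`exists_inv_mul_η_mem`). If 𝔮
⊆ 𝔭 and 𝔭 contains no nontrivial η(g), this forces 𝔮 = 𝔭.

The other half: if 𝔭 contains η(g) ≠ 1, take a second chain with a point that η(g) moves, and use it
as the second coordinate of a lexicographic product whose first coordinate is the coset chain of 𝔭.
G acts positively on the product, freeness extends the action to F, and a point stabilizer is a
prime inside 𝔭 that omits η(g) (`exists_isPrimeSubgroup_le`). In the representable and Abelian cases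
totally ordered groups replace the actions, which keeps the target in the variety. -/

theorem IsConvexLSubgroup.sup_one_mem_iff {K : Subgroup H} (hK : IsConvexLSubgroup K) {z : H} :
    z ⊔ 1 ∈ K ↔ ∃ t ∈ K, z ≤ t :=
  ⟨fun h => ⟨_, h, le_sup_left⟩, fun ⟨_, ht, h⟩ =>
    hK.convex K.one_mem (hK.sup_mem ht K.one_mem) le_sup_right (sup_le_sup_right h 1)⟩

/-- Comparison of cosets becomes a single membership, so that totality is a disjunction that an
ultrafilter can decide. -/
theorem IsConvexLSubgroup.cosetLE_iff {K : Subgroup H} (hK : IsConvexLSubgroup K) {x y : H} :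
    CosetLE K x y ↔ x * y⁻¹ ⊔ 1 ∈ K := by
  simp only [hK.sup_one_mem_iff, CosetLE, mul_inv_le_iff_le_mul]

/-- The positive part of each element or of its inverse lies in `K`. -/
def HasTotalCosets (K : Subgroup H) : Prop := ∀ z : H, z ⊔ 1 ∈ K ∨ z⁻¹ ⊔ 1 ∈ K

theorem IsConvexLSubgroup.isPrimeSubgroup {K : Subgroup H} (hK : IsConvexLSubgroup K)
    (ht : HasTotalCosets K) (hp : K ≠ ⊤) : IsPrimeSubgroup K where
  toIsConvexLSubgroup := hK
  proper := hp
  total x y := by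
    rw [hK.cosetLE_iff, hK.cosetLE_iff]
    simpa using ht (x * y⁻¹)

theorem IsPrimeSubgroup.hasTotalCosets {K : Subgroup H} (hK : IsPrimeSubgroup K) :
    HasTotalCosets K := by
  intro z
  have h := hK.total z 1
  rw [hK.cosetLE_iff, hK.cosetLE_iff] at h
  simpa using h

/-- The positive parts of z and z⁻¹ are disjoint: their meet is (z ⊓ 1)(z⁻¹ ⊔ 1) = 1. -/
theorem hasTotalCosets_of_disjoint {K : Subgroup H}
    (h : ∀ x y : H, x ⊓ y = 1 → x ∈ K ∨ y ∈ K) : HasTotalCosets K := by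
  intro z
  have hz : z * (z⁻¹ ⊔ 1) = z ⊔ 1 := by rw [mul_sup, mul_inv_cancel, mul_one, sup_comm]
  have h1 : (z ⊓ 1) * (z⁻¹ ⊔ 1) = 1 := by
    have : (z⁻¹ ⊔ 1) = (z ⊓ 1)⁻¹ := by rw [inv_inf, inv_one]
    rw [this, mul_inv_cancel]
  refine h _ _ ?_
  calc (z ⊔ 1) ⊓ (z⁻¹ ⊔ 1) = z * (z⁻¹ ⊔ 1) ⊓ 1 * (z⁻¹ ⊔ 1) := by rw [hz, one_mul]
    _ = 1 := by rw [← inf_mul, h1]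

/-- The limit of a family of subgroups along an ultrafilter. -/
def ultralimit {ι : Type v} (U : Ultrafilter ι) (K : ι → Subgroup H) : Subgroup H where
  carrier := {x | ∀ᶠ i in U, x ∈ K i}
  one_mem' := Filter.Eventually.of_forall fun i => (K i).one_mem
  mul_mem' hx hy := by
    filter_upwards [hx, hy] with i h1 h2 using (K i).mul_mem h1 h2
  inv_mem' hx := by
    filter_upwards [hx] with i h1 using (K i).inv_mem h1

theorem mem_ultralimit {ι : Type v} {U : Ultrafilter ι} {K : ι → Subgroup H} {x : H} :
    x ∈ ultralimit U K ↔ ∀ᶠ i in U, x ∈ K i := Iff.rfl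

theorem isConvexLSubgroup_ultralimit {ι : Type v} (U : Ultrafilter ι) {K : ι → Subgroup H}
    (hK : ∀ i, IsConvexLSubgroup (K i)) : IsConvexLSubgroup (ultralimit U K) where
  sup_mem hx hy := by
    rw [mem_ultralimit] at *
    filter_upwards [hx, hy] with i h1 h2 using (hK i).sup_mem h1 h2
  inf_mem hx hy := by
    rw [mem_ultralimit] at *
    filter_upwards [hx, hy] with i h1 h2 using (hK i).inf_mem h1 h2
  convex hx hz hxy hyz := by
    rw [mem_ultralimit] at *
    filter_upwards [hx, hz] with i h1 h2 using (hK i).convex h1 h2 hxy hyz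

/-- An ultrafilter that contains a union of two sets contains one of them. Properness may be lost in
an ultralimit, which is why `HasTotalCosets` leaves it out. -/
theorem hasTotalCosets_ultralimit {ι : Type v} (U : Ultrafilter ι) {K : ι → Subgroup H}
    (hK : ∀ i, HasTotalCosets (K i)) : HasTotalCosets (ultralimit U K) := fun z =>
  Ultrafilter.eventually_or.mp (Filter.Eventually.of_forall fun i => hK i z)

theorem isConvexLSubgroup_ker {T : Type v} [Group T] [Lattice T] [MulLeftMono T]
    [MulRightMono T] {f : H →* T} (hf : IsLHom f) : IsConvexLSubgroup f.ker where
  sup_mem hx hy := by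
    rw [MonoidHom.mem_ker] at *
    rw [hf.map_sup, hx, hy, sup_idem]
  inf_mem hx hy := by
    rw [MonoidHom.mem_ker] at *
    rw [hf.map_inf, hx, hy, inf_idem]
  convex {x y z} hx hz hxy hyz := by
    rw [MonoidHom.mem_ker] at *
    have h1 := hf.map_sup x y
    have h2 := hf.map_sup y z
    rw [sup_eq_right.mpr hxy, hx, eq_comm, sup_eq_right] at h1
    rw [sup_eq_right.mpr hyz, hz, eq_comm, sup_eq_right] at h2
    exact le_antisymm h2 h1

theorem hasTotalCosets_ker {T : Type v} [Group T] [LinearOrder T] [MulLeftMono T]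
    [MulRightMono T] {f : H →* T} (hf : IsLHom f) : HasTotalCosets f.ker := by
  intro z
  simp only [MonoidHom.mem_ker, hf.map_sup, map_one, map_inv]
  rcases le_total (f z) 1 with h | h
  · exact Or.inl (sup_eq_right.mpr h)
  · exact Or.inr (sup_eq_right.mpr (inv_le_one'.mpr h))

end TotalSubgroups

/-! ### Existence of primes that omit a given element -/

section Existence

variable {H : Type u} [Group H] [Lattice H] [MulLeftMono H] [MulRightMono H]

theorem inf_mul_eq_one {a x y : H} (ha : 1 ≤ a) (hx : 1 ≤ x) (hy : 1 ≤ y)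
    (hxa : x ⊓ a = 1) (hya : y ⊓ a = 1) : x * y ⊓ a = 1 := by
  refine le_antisymm ?_ (le_inf (one_le_mul hx hy) ha)
  calc x * y ⊓ a ≤ (x ⊓ a) * (y ⊓ a) := by
        rw [mul_inf, inf_mul, inf_mul]
        refine le_inf (le_inf inf_le_left ?_) (le_inf ?_ ?_)
        · exact inf_le_right.trans (le_mul_of_one_le_right' hy)
        · exact inf_le_right.trans (le_mul_of_one_le_left' hx)
        · exact inf_le_right.trans (le_mul_of_one_le_left' ha)
    _ = 1 := by rw [hxa, hya, mul_one]

theorem inf_eq_one_of_le {a x y : H} (ha : 1 ≤ a) (hx : 1 ≤ x) (hxy : x ≤ y)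
    (hya : y ⊓ a = 1) : x ⊓ a = 1 :=
  le_antisymm (hya ▸ inf_le_inf_right a hxy) (le_inf hx ha)

/-- The third factor pays for noncommutativity: the inverse of x * y has its factors in reverse
order. -/
theorem mabs_mul_le_mul_mul (x y : H) : |x * y|ₘ ≤ |x|ₘ * |y|ₘ * |x|ₘ := by
  refine sup_le ?_ ?_
  · calc x * y ≤ |x|ₘ * |y|ₘ := mul_le_mul' (le_mabs_self x) (le_mabs_self y)
      _ ≤ _ := le_mul_of_one_le_right' (one_le_mabs x)
  · rw [mul_inv_rev, mul_assoc]
    calc y⁻¹ * x⁻¹ ≤ |y|ₘ * |x|ₘ := mul_le_mul' (inv_le_mabs y) (inv_le_mabs x)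
      _ ≤ _ := le_mul_of_one_le_left' (one_le_mabs x)

/-- The elements that are disjoint from some member of a down-directed set of positive elements. -/
def polarUnion (U : Set H) (hne : U.Nonempty) (hpos : ∀ a ∈ U, 1 ≤ a)
    (hinf : ∀ a ∈ U, ∀ b ∈ U, a ⊓ b ∈ U) : Subgroup H where
  carrier := {x | ∃ a ∈ U, |x|ₘ ⊓ a = 1}
  one_mem' := by
    obtain ⟨a, ha⟩ := hne
    exact ⟨a, ha, by rw [mabs_one, inf_eq_left.mpr (hpos a ha)]⟩
  mul_mem' := by
    rintro x y ⟨a, ha, hxa⟩ ⟨b, hb, hyb⟩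
    have hc := hpos _ (hinf a ha b hb)
    have hx : |x|ₘ ⊓ (a ⊓ b) = 1 :=
      le_antisymm (hxa ▸ inf_le_inf_left _ inf_le_left) (le_inf (one_le_mabs x) hc)
    have hy : |y|ₘ ⊓ (a ⊓ b) = 1 :=
      le_antisymm (hyb ▸ inf_le_inf_left _ inf_le_right) (le_inf (one_le_mabs y) hc)
    refine ⟨_, hinf a ha b hb, inf_eq_one_of_le hc (one_le_mabs _) (mabs_mul_le_mul_mul x y) ?_⟩
    exact inf_mul_eq_one hc (one_le_mul (one_le_mabs x) (one_le_mabs y)) (one_le_mabs x)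
      (inf_mul_eq_one hc (one_le_mabs x) (one_le_mabs y) hx hy) hx
  inv_mem' := by
    rintro x ⟨a, ha, hxa⟩
    exact ⟨a, ha, by rwa [mabs_inv]⟩

theorem mabs_le_of_le_of_le {x y z : H} (hxy : x ≤ y) (hyz : y ≤ z) : |y|ₘ ≤ |x|ₘ * |z|ₘ := by
  refine sup_le ?_ ?_
  · exact (hyz.trans (le_mabs_self z)).trans (le_mul_of_one_le_left' (one_le_mabs x))
  · exact ((inv_le_inv_iff.mpr hxy).trans (inv_le_mabs x)).trans
      (le_mul_of_one_le_right' (one_le_mabs z))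

/-- Both x ⊓ y and x ⊔ y are trapped between |x|⁻¹|y|⁻¹ and |x||y|, so convexity gives closure under
the lattice operations. -/
theorem isConvexLSubgroup_of_mabs_mem {K : Subgroup H}
    (h : ∀ x y : H, |x|ₘ ≤ |y|ₘ → y ∈ K → x ∈ K) : IsConvexLSubgroup K := by
  have hab : ∀ {x}, x ∈ K → |x|ₘ ∈ K := fun hx => h _ _ (mabs_mabs _).le hx
  have hc : ∀ {x y z}, x ∈ K → z ∈ K → x ≤ y → y ≤ z → y ∈ K := fun {x y z} hx hz hxy hyz =>
    h _ _ ((mabs_le_of_le_of_le hxy hyz).trans (le_mabs_self _)) (K.mul_mem (hab hx) (hab hz))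
  have hlo : ∀ x y : H, |x|ₘ⁻¹ * |y|ₘ⁻¹ ≤ x ⊓ y := fun x y => le_inf
    ((mul_le_of_le_one_right' (inv_le_one'.mpr (one_le_mabs y))).trans (inv_le_of_inv_le' (inv_le_mabs x)))
    ((mul_le_of_le_one_left' (inv_le_one'.mpr (one_le_mabs x))).trans (inv_le_of_inv_le' (inv_le_mabs y)))
  have hup : ∀ x y : H, x ⊔ y ≤ |x|ₘ * |y|ₘ := fun x y => sup_le
    ((le_mabs_self x).trans (le_mul_of_one_le_right' (one_le_mabs y)))
    ((le_mabs_self y).trans (le_mul_of_one_le_left' (one_le_mabs x)))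
  have hlo' : ∀ {x y}, x ∈ K → y ∈ K → |x|ₘ⁻¹ * |y|ₘ⁻¹ ∈ K := fun hx hy =>
    K.mul_mem (K.inv_mem (hab hx)) (K.inv_mem (hab hy))
  have hup' : ∀ {x y}, x ∈ K → y ∈ K → |x|ₘ * |y|ₘ ∈ K := fun hx hy => K.mul_mem (hab hx) (hab hy)
  exact
    { sup_mem := fun {x y} hx hy =>
        hc (hlo' hx hy) (hup' hx hy) ((hlo x y).trans inf_le_sup) (hup x y)
      inf_mem := fun {x y} hx hy =>
        hc (hlo' hx hy) (hup' hx hy) (hlo x y) (inf_le_sup.trans (hup x y))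
      convex := hc }

theorem isConvexLSubgroup_polarUnion (U : Set H) (hne : U.Nonempty) (hpos : ∀ a ∈ U, 1 ≤ a)
    (hinf : ∀ a ∈ U, ∀ b ∈ U, a ⊓ b ∈ U) : IsConvexLSubgroup (polarUnion U hne hpos hinf) :=
  isConvexLSubgroup_of_mabs_mem fun x _ hxy ⟨a, ha, hya⟩ =>
    ⟨a, ha, inf_eq_one_of_le (hpos a ha) (one_le_mabs x) hxy hya⟩

/-- Each element other than the identity is outside some prime subgroup. -/
theorem exists_isPrimeSubgroup_notMem {g : H} (hg : g ≠ 1) :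
    ∃ K : Subgroup H, IsPrimeSubgroup K ∧ g ∉ K := by
  -- A maximal member of `S` above {|g|} behaves like an ultrafilter of positive elements; the
  -- elements disjoint from one of its members form the prime.
  let S : Set (Set H) := {U | (∀ a ∈ U, 1 ≤ a) ∧ (∀ a ∈ U, ∀ b ∈ U, a ⊓ b ∈ U) ∧ (1 : H) ∉ U}
  have hg' : |g|ₘ ≠ 1 := fun h => hg <| le_antisymm (h ▸ le_mabs_self g)
    (inv_le_one'.mp (h ▸ inv_le_mabs g))
  have h0 : {|g|ₘ} ∈ S := by
    refine ⟨?_, ?_, ?_⟩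
    · rintro a rfl
      exact one_le_mabs g
    · rintro a rfl b rfl
      exact inf_idem _
    · exact fun h => hg' (Set.mem_singleton_iff.mp h).symm
  obtain ⟨U, hgU, hU⟩ := zorn_subset_nonempty S (by
    intro c hc hchain hne
    refine ⟨⋃₀ c, ⟨?_, ?_, ?_⟩, fun s hs => Set.subset_sUnion_of_mem hs⟩
    · rintro a ⟨s, hs, ha⟩
      exact (hc hs).1 a ha
    · rintro a ⟨s, hs, ha⟩ b ⟨t, ht, hb⟩
      rcases hchain.total hs ht with h | h
      · exact ⟨t, ht, (hc ht).2.1 a (h ha) b hb⟩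
      · exact ⟨s, hs, (hc hs).2.1 a ha b (h hb)⟩
    · rintro ⟨s, hs, h1⟩
      exact (hc hs).2.2 h1) _ h0
  obtain ⟨hpos, hinf, h1⟩ := hU.prop
  have hgU : |g|ₘ ∈ U := hgU rfl
  have hconv := isConvexLSubgroup_polarUnion U ⟨_, hgU⟩ hpos hinf
  have hgK : g ∉ polarUnion U ⟨_, hgU⟩ hpos hinf := by
    rintro ⟨a, ha, h⟩
    exact h1 (h ▸ hinf _ hgU a ha)
  refine ⟨_, hconv.isPrimeSubgroup (hasTotalCosets_of_disjoint fun x y hxy => ?_)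
    (fun h => hgK (h ▸ Subgroup.mem_top g)), hgK⟩
  have hx : 1 ≤ x := hxy ▸ inf_le_left
  have hy : 1 ≤ y := hxy ▸ inf_le_right
  refine or_iff_not_imp_left.mpr fun hxK => ?_
  have hxa : ∀ a ∈ U, x ⊓ a ≠ 1 := fun a ha h => hxK ⟨a, ha, by rwa [mabs_of_one_le hx]⟩
  have hxU : x ∈ U := by
    -- The closure of U ∪ {x} under meets. It avoids 1 because x is disjoint from no member of U, so
    -- maximality puts x into U; then y, disjoint from x, is in the subgroup.
    let W : Set H := U ∪ {z | z = x ∨ ∃ a ∈ U, z = x ⊓ a}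
    have hW : W ∈ S := by
      refine ⟨?_, ?_, ?_⟩
      · rintro z (hz | rfl | ⟨a, ha, rfl⟩)
        · exact hpos z hz
        · exact hx
        · exact le_inf hx (hpos a ha)
      · rintro z (hz | rfl | ⟨a, ha, rfl⟩) w (hw | rfl | ⟨b, hb, rfl⟩)
        · exact Or.inl (hinf z hz w hw)
        · exact Or.inr (Or.inr ⟨z, hz, inf_comm _ _⟩)
        · exact Or.inr (Or.inr ⟨z ⊓ b, hinf z hz b hb, inf_left_comm _ _ _⟩)
        · exact Or.inr (Or.inr ⟨w, hw, rfl⟩)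
        · exact Or.inr (Or.inl (inf_idem _))
        · exact Or.inr (Or.inr ⟨b, hb, by rw [← inf_assoc, inf_idem]⟩)
        · exact Or.inr (Or.inr ⟨a ⊓ w, hinf a ha w hw, inf_assoc _ _ _⟩)
        · exact Or.inr (Or.inr ⟨a, ha, by rw [inf_right_comm, inf_idem]⟩)
        · exact Or.inr (Or.inr ⟨a ⊓ b, hinf a ha b hb, by rw [← inf_inf_distrib_left]⟩)
      · rintro (h | h | ⟨a, ha, h⟩)
        · exact h1 h
        · exact hxa _ hgU (by rw [← h, inf_eq_left.mpr (one_le_mabs g)])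
        · exact hxa a ha h.symm
    exact hU.le_of_ge hW Set.subset_union_left (Or.inr (Or.inl rfl))
  exact ⟨x, hxU, by rw [mabs_of_one_le hy, inf_comm, hxy]⟩

end Existence

/-! ### The ℓ-group of automorphisms of a chain, and its actions -/

section Automorphisms

variable {A : Type u} [LinearOrder A]

/-- The order automorphisms of a chain form a lattice, with pointwise operations. -/
instance : Lattice (A ≃o A) where
  toPartialOrder := PartialOrder.lift (fun f : A ≃o A => (f : A → A)) DFunLike.coe_injective
  sup f g :=
    { toFun := fun a => f a ⊔ g a
      -- Inversion reverses the order, so the inverse of a join is the meet of the inverses.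
      invFun := fun a => f.symm a ⊓ g.symm a
      left_inv := fun a => by
        beta_reduce
        rw [f.symm.map_sup, g.symm.map_sup, f.symm_apply_apply, g.symm_apply_apply]
        refine le_antisymm ?_ (le_inf le_sup_left le_sup_right)
        rcases le_total (f a) (g a) with h | h
        · exact inf_le_right.trans (sup_le ((g.symm_apply_le).mpr h) le_rfl)
        · exact inf_le_left.trans (sup_le le_rfl ((f.symm_apply_le).mpr h))
      right_inv := fun a => by
        beta_reduce
        rw [f.map_inf, g.map_inf, f.apply_symm_apply, g.apply_symm_apply]
        refine le_antisymm (sup_le inf_le_left inf_le_right) ?_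
        rcases le_total (f.symm a) (g.symm a) with h | h
        · exact le_trans (le_inf le_rfl ((f.symm_apply_le).mp h)) le_sup_left
        · exact le_trans (le_inf ((g.symm_apply_le).mp h) le_rfl) le_sup_right
      map_rel_iff' := fun {a b} => by
        have hm : StrictMono fun a => f a ⊔ g a := fun _ _ h => max_lt_max (f.strictMono h) (g.strictMono h)
        exact hm.le_iff_le }
  inf f g :=
    { toFun := fun a => f a ⊓ g a
      invFun := fun a => f.symm a ⊔ g.symm a
      left_inv := fun a => by
        beta_reduce
        rw [f.symm.map_inf, g.symm.map_inf, f.symm_apply_apply, g.symm_apply_apply]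
        refine le_antisymm (sup_le inf_le_left inf_le_right) ?_
        rcases le_total (f a) (g a) with h | h
        · exact le_trans (le_inf le_rfl ((f.le_symm_apply).mpr (by simpa using h))) le_sup_left
        · exact le_trans (le_inf ((g.le_symm_apply).mpr (by simpa using h)) le_rfl) le_sup_right
      right_inv := fun a => by
        beta_reduce
        rw [f.map_sup, g.map_sup, f.apply_symm_apply, g.apply_symm_apply]
        refine le_antisymm ?_ (le_inf le_sup_left le_sup_right)
        rcases le_total (f.symm a) (g.symm a) with h | h
        · exact inf_le_right.trans (sup_le ((g.le_symm_apply).mp h) le_rfl)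
        · exact inf_le_left.trans (sup_le le_rfl ((f.le_symm_apply).mp h))
      map_rel_iff' := fun {a b} => by
        have hm : StrictMono fun a => f a ⊓ g a := fun _ _ h => min_lt_min (f.strictMono h) (g.strictMono h)
        exact hm.le_iff_le }
  le_sup_left _ _ _ := le_sup_left
  le_sup_right _ _ _ := le_sup_right
  sup_le _ _ _ h₁ h₂ a := sup_le (h₁ a) (h₂ a)
  inf_le_left _ _ _ := inf_le_left
  inf_le_right _ _ _ := inf_le_right
  le_inf _ _ _ h₁ h₂ a := le_inf (h₁ a) (h₂ a)

theorem orderIso_sup_apply (f g : A ≃o A) (a : A) : (f ⊔ g) a = f a ⊔ g a := rfl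

theorem orderIso_inf_apply (f g : A ≃o A) (a : A) : (f ⊓ g) a = f a ⊓ g a := rfl

instance : MulLeftMono (A ≃o A) := ⟨fun f _ _ h a => f.monotone (h a)⟩

instance : MulRightMono (A ≃o A) := ⟨fun f _ _ h a => h (f a)⟩

variable {H : Type v} [Group H] [Lattice H] [MulLeftMono H] [MulRightMono H]

/-- The stabilizer of a point under an action on a chain. -/
def stabilizer (ρ : H →* (A ≃o A)) (a : A) : Subgroup H where
  carrier := {x | ρ x a = a}
  one_mem' := by simp
  mul_mem' {x y} hx hy := by
    rw [Set.mem_ofPred_eq] at *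
    rw [map_mul, RelIso.mul_apply, hy, hx]
  inv_mem' {x} hx := by
    rw [Set.mem_ofPred_eq] at *
    rw [map_inv]
    nth_rw 1 [← hx]
    exact RelIso.inv_apply_self _ _

theorem mem_stabilizer {ρ : H →* (A ≃o A)} {a : A} {x : H} :
    x ∈ stabilizer ρ a ↔ ρ x a = a := Iff.rfl

theorem IsLHom.monotone {K : Type w} [Group K] [Lattice K] {f : H →* K} (hf : IsLHom f) :
    Monotone f := fun x y h => by
  rw [← sup_eq_right, ← hf.map_sup, sup_eq_right.mpr h]

theorem isConvexLSubgroup_stabilizer {ρ : H →* (A ≃o A)} (hρ : IsLHom ρ) (a : A) :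
    IsConvexLSubgroup (stabilizer ρ a) where
  sup_mem hx hy := by
    rw [mem_stabilizer] at *
    rw [hρ.map_sup, orderIso_sup_apply, hx, hy, sup_idem]
  inf_mem hx hy := by
    rw [mem_stabilizer] at *
    rw [hρ.map_inf, orderIso_inf_apply, hx, hy, inf_idem]
  convex hx hz hxy hyz := by
    rw [mem_stabilizer] at *
    exact le_antisymm ((hρ.monotone hyz a).trans_eq hz) (hx.symm.trans_le (hρ.monotone hxy a))

/-- One of z and z⁻¹ does not move the point up, and the positive part of that one fixes it. -/
theorem hasTotalCosets_stabilizer {ρ : H →* (A ≃o A)} (hρ : IsLHom ρ) (a : A) :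
    HasTotalCosets (stabilizer ρ a) := by
  intro z
  simp only [mem_stabilizer, hρ.map_sup, orderIso_sup_apply, map_one, RelIso.one_apply,
    sup_eq_right]
  rcases le_total (ρ z a) a with h | h
  · exact Or.inl h
  · right
    rw [map_inv]
    exact ((ρ z).symm_apply_le).mpr h

end Automorphisms

/-! ### The chain of left cosets -/

section Cosets

variable {H : Type u} [Group H] [Lattice H] [MulLeftMono H] [MulRightMono H] {K : Subgroup H}

/-- The order of the left cosets induced by the order of the group. -/
instance leftCosetLE : LE (H ⧸ K) :=
  ⟨fun q r => ∃ x y : H, (x : H ⧸ K) = q ∧ (y : H ⧸ K) = r ∧ x ≤ y⟩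

theorem mk_le_mk_iff {x y : H} : (x : H ⧸ K) ≤ (y : H ⧸ K) ↔ ∃ t ∈ K, x ≤ y * t := by
  constructor
  · rintro ⟨x', y', hx, hy, h⟩
    rw [QuotientGroup.eq] at hx hy
    refine ⟨y⁻¹ * y' * (x'⁻¹ * x), K.mul_mem ?_ hx, ?_⟩
    · simpa using K.inv_mem hy
    · calc x = x' * (x'⁻¹ * x) := by group
        _ ≤ y' * (x'⁻¹ * x) := mul_le_mul_left h _
        _ = _ := by group
  · rintro ⟨t, ht, h⟩
    exact ⟨x, y * t, rfl, QuotientGroup.mk_mul_of_mem y ht, h⟩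

theorem mk_mono {x y : H} (h : x ≤ y) : (x : H ⧸ K) ≤ (y : H ⧸ K) := ⟨x, y, rfl, rfl, h⟩

/-- The chain of left cosets of a convex ℓ-subgroup with totally ordered cosets. -/
@[reducible]
noncomputable def cosetLinearOrder (hK : IsConvexLSubgroup K) (ht : HasTotalCosets K) :
    LinearOrder (H ⧸ K) where
  toLE := leftCosetLE
  le_refl q := by
    induction q using QuotientGroup.induction_on with | H x => exact mk_mono le_rfl
  le_trans q r s := by
    induction q using QuotientGroup.induction_on with | H x =>
    induction r using QuotientGroup.induction_on with | H y =>
    induction s using QuotientGroup.induction_on with | H z =>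
    simp only [mk_le_mk_iff]
    rintro ⟨t, ht, h⟩ ⟨t', ht', h'⟩
    refine ⟨t' * t, K.mul_mem ht' ht, h.trans ?_⟩
    rw [← mul_assoc]
    exact mul_le_mul_left h' _
  le_antisymm q r := by
    induction q using QuotientGroup.induction_on with | H x =>
    induction r using QuotientGroup.induction_on with | H y =>
    simp only [mk_le_mk_iff]
    rintro ⟨t, ht, h⟩ ⟨t', ht', h'⟩
    rw [QuotientGroup.eq]
    refine hK.convex (K.inv_mem ht) ht' ?_ (inv_mul_le_iff_le_mul.mpr h')
    rw [inv_le', mul_inv_rev, inv_inv]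
    exact inv_mul_le_iff_le_mul.mpr h
  le_total q r := by
    induction q using QuotientGroup.induction_on with | H x =>
    induction r using QuotientGroup.induction_on with | H y =>
    -- `HasTotalCosets` mentions no side, so totality passes from the right cosets in the definition
    -- of primes to the left cosets, on which H acts from the left.
    simp only [mk_le_mk_iff, ← inv_mul_le_iff_le_mul, ← hK.sup_one_mem_iff]
    simpa using ht (y⁻¹ * x)
  toDecidableLE := Classical.decRel _

theorem smul_mono_coset (x : H) {q r : H ⧸ K} (h : q ≤ r) : x • q ≤ x • r := by
  obtain ⟨y, z, rfl, rfl, h⟩ := h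
  exact mk_mono (mul_le_mul_right h x)

/-- If x ≤ y t with t in K, then x ⊔ y ≤ y (t ⊔ 1), so the larger coset absorbs the join. -/
theorem mk_sup (hK : IsConvexLSubgroup K) (ht : HasTotalCosets K) (x y : H) :
    letI := cosetLinearOrder hK ht
    ((x ⊔ y : H) : H ⧸ K) = (x : H ⧸ K) ⊔ (y : H ⧸ K) := by
  let _ := cosetLinearOrder hK ht
  have key : ∀ x y : H, (x : H ⧸ K) ≤ y → ((x ⊔ y : H) : H ⧸ K) = (y : H ⧸ K) := by
    intro x y h
    refine le_antisymm ?_ (mk_mono le_sup_right)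
    obtain ⟨t, ht, h⟩ := mk_le_mk_iff.mp h
    refine mk_le_mk_iff.mpr ⟨t ⊔ 1, hK.sup_mem ht K.one_mem, sup_le ?_ ?_⟩
    · exact h.trans (mul_le_mul_right le_sup_left y)
    · exact le_mul_of_one_le_right' le_sup_right
  rcases le_total (x : H ⧸ K) y with h | h
  · rw [key x y h, sup_eq_right.mpr h]
  · rw [sup_comm x y, key y x h, sup_eq_left.mpr h]

theorem mk_inf (hK : IsConvexLSubgroup K) (ht : HasTotalCosets K) (x y : H) :
    letI := cosetLinearOrder hK ht
    ((x ⊓ y : H) : H ⧸ K) = (x : H ⧸ K) ⊓ (y : H ⧸ K) := by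
  let _ := cosetLinearOrder hK ht
  have key : ∀ x y : H, (x : H ⧸ K) ≤ y → ((x ⊓ y : H) : H ⧸ K) = (x : H ⧸ K) := by
    intro x y h
    refine le_antisymm (mk_mono inf_le_left) ?_
    obtain ⟨t, ht, h⟩ := mk_le_mk_iff.mp h
    refine mk_le_mk_iff.mpr ⟨t ⊔ 1, hK.sup_mem ht K.one_mem, ?_⟩
    rw [inf_mul]
    refine le_inf (le_mul_of_one_le_right' le_sup_right) ?_
    exact h.trans (mul_le_mul_right le_sup_left y)
  rcases le_total (x : H ⧸ K) y with h | h
  · rw [key x y h, inf_eq_left.mpr h]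
  · rw [inf_comm x y, key y x h, inf_eq_right.mpr h]

/-- A convex ℓ-subgroup with totally ordered cosets is a point stabilizer of an action by
ℓ-automorphisms on a chain. -/
theorem exists_chain_action (hK : IsConvexLSubgroup K) (ht : HasTotalCosets K) :
    ∃ (A : Type u) (_ : LinearOrder A) (ρ : H →* (A ≃o A)) (a : A),
      IsLHom ρ ∧ stabilizer ρ a = K := by
  let _ := cosetLinearOrder hK ht
  let ρ : H →* ((H ⧸ K) ≃o (H ⧸ K)) :=
    { toFun := fun x =>
        { toEquiv := MulAction.toPerm x
          map_rel_iff' := fun {q r} => by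
            refine ⟨fun h => ?_, smul_mono_coset x⟩
            simpa using smul_mono_coset x⁻¹ h }
      map_one' := by
        ext q
        exact one_smul H q
      map_mul' := fun x y => by
        ext q
        exact mul_smul x y q }
  refine ⟨H ⧸ K, inferInstance, ρ, ((1 : H) : H ⧸ K), ⟨fun x y => ?_, fun x y => ?_⟩, ?_⟩
  · ext q
    induction q using QuotientGroup.induction_on with | H z =>
    refine Eq.trans ?_ (mk_sup hK ht (x * z) (y * z))
    rw [← sup_mul]
    rfl
  · ext q
    induction q using QuotientGroup.induction_on with | H z =>
    refine Eq.trans ?_ (mk_inf hK ht (x * z) (y * z))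
    rw [← inf_mul]
    rfl
  · ext x
    change ((x * 1 : H) : H ⧸ K) = ((1 : H) : H ⧸ K) ↔ x ∈ K
    rw [mul_one, eq_comm, QuotientGroup.eq, inv_one, one_mul]

/-- A normal convex ℓ-subgroup with totally ordered cosets is the kernel of an ℓ-homomorphism onto
a totally ordered group. -/
theorem exists_chain_quotient (hK : IsConvexLSubgroup K) (ht : HasTotalCosets K) [K.Normal] :
    ∃ (T : Type u) (_ : Group T) (_ : LinearOrder T) (_ : MulLeftMono T) (_ : MulRightMono T)
      (f : H →* T), IsLHom f ∧ Function.Surjective f ∧ f.ker = K := by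
  let _ := cosetLinearOrder hK ht
  refine ⟨H ⧸ K, inferInstance, inferInstance, ⟨?_⟩, ⟨?_⟩, QuotientGroup.mk' K,
    ⟨mk_sup hK ht, mk_inf hK ht⟩, QuotientGroup.mk'_surjective K, QuotientGroup.ker_mk' K⟩
  · rintro q _ _ ⟨x, y, rfl, rfl, h⟩
    induction q using QuotientGroup.induction_on with | H z =>
    exact mk_mono (mul_le_mul_right h z)
  · rintro q _ _ ⟨x, y, rfl, rfl, h⟩
    induction q using QuotientGroup.induction_on with | H z =>
    exact mk_mono (mul_le_mul_left h z)

end Cosets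

/-! ### Normal primes in representable ℓ-groups -/

section Representable

variable {H : Type u} [Group H] [Lattice H] [MulLeftMono H] [MulRightMono H]

theorem isRepresentable_of_linearOrder (T : Type u) [Group T] [LinearOrder T] [MulLeftMono T]
    [MulRightMono T] : IsRepresentable T :=
  ⟨PUnit, fun _ => T, fun _ => inferInstance, fun _ => inferInstance, fun _ => inferInstance,
    fun _ => inferInstance, fun _ => MonoidHom.id T, fun _ => ⟨fun _ _ => rfl, fun _ _ => rfl⟩,
    fun _ => Function.surjective_id, fun _ _ h => h PUnit.unit⟩

/-- In a representable ℓ-group, each prime subgroup contains a normal one. -/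
theorem IsRepresentable.exists_normal_le (hH : IsRepresentable H) {K : Subgroup H}
    (hK : IsPrimeSubgroup K) : ∃ N : Subgroup H, IsPrimeSubgroup N ∧ N.Normal ∧ N ≤ K := by
  obtain ⟨ι, T, _, _, _, _, f, hf, -, hinj⟩ := hH
  -- The supports of the elements outside K form a filter base: as K is prime, |x| ⊓ |y| is outside
  -- K along with x and y, and its support lies in both of theirs. An ultrafilter containing these
  -- supports makes the ultralimit of the kernels fall inside K.
  let L : {x : H // x ∉ K} → Filter ι := fun x => Filter.principal {i | f i x ≠ 1}
  have hsub : Nonempty {x : H // x ∉ K} := by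
    by_contra h
    rw [nonempty_subtype, not_exists] at h
    exact hK.proper (eq_top_iff.mpr fun x _ => not_not.mp (h x))
  have hne : (⨅ x, L x).NeBot := by
    refine Filter.iInf_neBot_of_directed' ?_ ?_
    · rintro ⟨x, hx⟩ ⟨y, hy⟩
      refine ⟨⟨|x|ₘ ⊓ |y|ₘ, fun h => (hK.inf_mabs_mem_iff.mp h).elim hx hy⟩, ?_, ?_⟩
      · refine Filter.principal_mono.mpr fun i hi h => hi ?_
        have hk := isConvexLSubgroup_ker (hf i)
        exact hk.convex (Subgroup.one_mem _) (hk.mabs_mem_iff.mpr h)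
          (le_inf (one_le_mabs x) (one_le_mabs y)) inf_le_left
      · refine Filter.principal_mono.mpr fun i hi h => hi ?_
        have hk := isConvexLSubgroup_ker (hf i)
        exact hk.convex (Subgroup.one_mem _) (hk.mabs_mem_iff.mpr h)
          (le_inf (one_le_mabs x) (one_le_mabs y)) inf_le_right
    · rintro ⟨x, hx⟩
      rw [Filter.principal_neBot_iff]
      by_contra h
      rw [Set.not_nonempty_iff_eq_empty, Set.eq_empty_iff_forall_notMem] at h
      have h1 : x = 1 := hinj x 1 fun i => by
        rw [map_one]
        exact not_not.mp (h i)
      exact hx (h1 ▸ K.one_mem)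
  let U : Ultrafilter ι := Ultrafilter.of (⨅ x, L x)
  have hle : ultralimit U (fun i => (f i).ker) ≤ K := by
    intro x hx
    by_contra hxK
    have h1 : ∀ᶠ i in (U : Filter ι), f i x ≠ 1 :=
      ((Ultrafilter.of_le _).trans (iInf_le L ⟨x, hxK⟩)) (Filter.mem_principal_self _)
    obtain ⟨i, hi, hi'⟩ := (h1.and hx).exists
    exact hi hi'
  refine ⟨_, (isConvexLSubgroup_ultralimit U fun i => isConvexLSubgroup_ker
    (hf i)).isPrimeSubgroup (hasTotalCosets_ultralimit U fun i => hasTotalCosets_ker (hf i)) ?_,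
    ⟨fun x hx y => ?_⟩, hle⟩
  · exact fun h => hK.proper (top_le_iff.mp (h ▸ hle))
  · rw [mem_ultralimit] at *
    filter_upwards [hx] with i hi using (MonoidHom.normal_ker (f i)).conj_mem x hi y

end Representable

/-! ### Lexicographic products of totally ordered groups -/

section Lex

variable {A : Type u} {B : Type v} [Group A] [LinearOrder A] [MulLeftMono A] [MulRightMono A]
  [Group B] [LinearOrder B] [MulLeftMono B] [MulRightMono B]

instance lexMulLeftMono : MulLeftMono (A ×ₗ B) := ⟨fun c x y h => by
  rw [Prod.Lex.le_iff] at *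
  rcases h with h | ⟨h, h'⟩
  · exact Or.inl (mul_lt_mul_right h _)
  · exact Or.inr ⟨congrArg ((ofLex c).1 * ·) h, mul_le_mul_right h' _⟩⟩

instance lexMulRightMono : MulRightMono (A ×ₗ B) := ⟨fun c x y h => by
  rw [Prod.Lex.le_iff] at *
  rcases h with h | ⟨h, h'⟩
  · exact Or.inl (mul_lt_mul_left h _)
  · exact Or.inr ⟨congrArg (· * (ofLex c).1) h, mul_le_mul_left h' _⟩⟩

end Lex

/-! ### Generators and minimal primes of the free ℓ-group -/

namespace FreeLGroup

variable {V : Variety} {G : Type u} [Group G] [PartialOrder G]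

/-- Joins and meets are spelled through the `Lattice` instance, to match those in `IsLHom`, rather
than through the bare `Max` and `Min` instances. -/
theorem induction {P : FreeLGroup V G → Prop} (of : ∀ g, P (η V G g))
    (mul : ∀ x y, P x → P y → P (x * y)) (inv : ∀ x, P x → P x⁻¹)
    (sup : ∀ x y, P x → P y → P (@max _ SemilatticeSup.toMax x y))
    (inf : ∀ x y, P x → P y → P (@min _ SemilatticeInf.toMin x y)) :
    ∀ x, P x := by
  rintro ⟨t⟩
  induction t with
  | of g => exact of g
  | one => exact of 1 |> (congrArg P (map_one (η V G))).mp
  | mul s t hs ht => exact mul _ _ hs ht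
  | inv s hs => exact inv _ hs
  | sup s t hs ht => exact sup _ _ hs ht
  | inf s t hs ht => exact inf _ _ hs ht

theorem hom_ext {K : Type v} [Group K] [Lattice K] {f h : FreeLGroup V G →* K} (hf : IsLHom f)
    (hh : IsLHom h) (heq : ∀ g, f (η V G g) = h (η V G g)) (x : FreeLGroup V G) : f x = h x := by
  induction x using induction with
  | of g => exact heq g
  | mul x y hx hy => rw [map_mul, map_mul, hx, hy]
  | inv x hx => rw [map_inv, map_inv, hx]
  | sup x y hx hy => rw [hf.map_sup, hh.map_sup, hx, hy]
  | inf x y hx hy => rw [hf.map_inf, hh.map_inf, hx, hy]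

theorem η_mono : Monotone (η V G) := isFreeOver.mono

theorem eq_one_of_forall_η_eq_one (h : ∀ g, η V G g = 1) (x : FreeLGroup V G) : x = 1 := by
  induction x using induction with
  | of g => exact h g
  | mul x y hx hy => rw [hx, hy, mul_one]
  | inv x hx => rw [hx, inv_one]
  | sup x y hx hy => rw [hx, hy, sup_idem]
  | inf x y hx hy => rw [hx, hy, inf_idem]

/-- A monotone map of chains that commutes with the actions of the generators commutes with
the actions of the free ℓ-group. -/
theorem equivariant {A : Type v} {B : Type w} [LinearOrder A] [LinearOrder B]
    {ρ : FreeLGroup V G →* (A ≃o A)} {σ : FreeLGroup V G →* (B ≃o B)} (hρ : IsLHom ρ)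
    (hσ : IsLHom σ) {π : A → B} (hπ : Monotone π)
    (heq : ∀ g a, π (ρ (η V G g) a) = σ (η V G g) (π a)) (x : FreeLGroup V G) :
    ∀ a, π (ρ x a) = σ x (π a) := by
  induction x using induction with
  | of g => exact heq g
  | mul x y hx hy =>
    intro a
    rw [map_mul, map_mul, RelIso.mul_apply, RelIso.mul_apply, hx, hy]
  | inv x hx =>
    intro a
    apply (σ x).injective
    rw [← hx, map_inv, map_inv, RelIso.apply_inv_self, RelIso.apply_inv_self]
  | sup x y hx hy =>
    intro a
    rw [hρ.map_sup, hσ.map_sup, orderIso_sup_apply, orderIso_sup_apply, hπ.map_sup, hx, hy]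
  | inf x y hx hy =>
    intro a
    rw [hρ.map_inf, hσ.map_inf, orderIso_inf_apply, orderIso_inf_apply, hπ.map_inf, hx, hy]

theorem exists_isPrimeSubgroup_le_all {K : Subgroup (FreeLGroup Variety.all G)}
    (hK : IsPrimeSubgroup K) {g : G} (hg : η Variety.all G g ≠ 1) :
    ∃ N : Subgroup (FreeLGroup Variety.all G),
      IsPrimeSubgroup N ∧ N ≤ K ∧ η Variety.all G g ∉ N := by
  obtain ⟨Q, hQ, hgQ⟩ := exists_isPrimeSubgroup_notMem hg
  obtain ⟨A, _, ρ, a, hρ, rfl⟩ := exists_chain_action hK.toIsConvexLSubgroup hK.hasTotalCosets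
  obtain ⟨B, _, σ, b, hσ, rfl⟩ := exists_chain_action hQ.toIsConvexLSubgroup hQ.hasTotalCosets
  -- Only G acts coordinatewise. The coordinatewise action of the whole free ℓ-group need not
  -- preserve joins for the lexicographic order, so `τ` below is the extension of `p` given by
  -- freeness.
  let p : G →* ((A ×ₗ B) ≃o (A ×ₗ B)) :=
    { toFun := fun g => Prod.Lex.prodLexCongr (ρ (η _ G g)) (σ (η _ G g))
      map_one' := by
        ext x
        simp only [map_one]
        rfl
      map_mul' := fun g h => by
        ext x
        simp only [map_mul]
        rfl }
  have hp : Monotone p := by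
    intro g h hgh x
    refine Prod.Lex.le_iff.mpr ?_
    have h1 : ρ (η _ G g) (ofLex x).1 ≤ ρ (η _ G h) (ofLex x).1 := hρ.monotone (η_mono hgh) _
    have h2 : σ (η _ G g) (ofLex x).2 ≤ σ (η _ G h) (ofLex x).2 := hσ.monotone (η_mono hgh) _
    exact h1.lt_or_eq.imp id fun h => ⟨h, h2⟩
  let τ := lift (V := Variety.all) trivial p hp
  have hτ : IsLHom τ := lift_isLHom _ p hp
  have hgN : η Variety.all G g ∉ stabilizer τ (toLex (a, b)) := fun h =>
    hgQ (congrArg (fun x : A ×ₗ B => (ofLex x).2) h)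
  refine ⟨_, (isConvexLSubgroup_stabilizer hτ (toLex (a, b))).isPrimeSubgroup
    (hasTotalCosets_stabilizer hτ _) (fun h => hgN (h ▸ Subgroup.mem_top _)), fun x hx => ?_, hgN⟩
  -- The first projection is monotone and equivariant, so whatever fixes (a, b) fixes a.
  have h := equivariant hτ hρ Prod.Lex.monotone_fst_ofLex (fun g x => rfl) x (toLex (a, b))
  rw [mem_stabilizer.mp hx] at h
  exact h.symm

/-- The lexicographic argument with totally ordered groups in place of chains: automorphism groups
of chains may lie outside V, whereas `hV` ensures that the target here does not. -/
theorem exists_isPrimeSubgroup_le_ker {A B : Type u} [Group A] [LinearOrder A] [MulLeftMono A]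
    [MulRightMono A] [Group B] [LinearOrder B] [MulLeftMono B] [MulRightMono B]
    (hV : V.Mem (A ×ₗ B)) {α : FreeLGroup V G →* A} {β : FreeLGroup V G →* B} (hα : IsLHom α)
    (hβ : IsLHom β) {g : G} (hg : β (η V G g) ≠ 1) :
    ∃ N : Subgroup (FreeLGroup V G), IsPrimeSubgroup N ∧ N ≤ α.ker ∧ η V G g ∉ N := by
  let p : G →* A ×ₗ B :=
    { toFun := fun g => toLex (α (η V G g), β (η V G g))
      map_one' := by
        simp only [map_one]
        rfl
      map_mul' := fun g h => by
        simp only [map_mul]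
        rfl }
  have hp : Monotone p := by
    intro g h hgh
    refine Prod.Lex.le_iff.mpr ?_
    exact (hα.monotone (η_mono hgh)).lt_or_eq.imp id fun h => ⟨h, hβ.monotone (η_mono hgh)⟩
  let τ := lift hV p hp
  have hτ : IsLHom τ := lift_isLHom _ p hp
  have hgN : η V G g ∉ τ.ker := fun h => hg (congrArg (fun x : A ×ₗ B => (ofLex x).2) h)
  let π : A ×ₗ B →* A :=
    { toFun := fun x => (ofLex x).1
      map_one' := rfl
      map_mul' := fun _ _ => rfl }
  have hπ : IsLHom (π.comp τ) :=
    ⟨fun x y => (congrArg π (hτ.map_sup x y)).trans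
        ((Prod.Lex.monotone_fst_ofLex (α := A) (β := B)).map_sup _ _),
      fun x y => (congrArg π (hτ.map_inf x y)).trans
        ((Prod.Lex.monotone_fst_ofLex (α := A) (β := B)).map_inf _ _)⟩
  refine ⟨_, (isConvexLSubgroup_ker hτ).isPrimeSubgroup (hasTotalCosets_ker hτ)
    (fun h => hgN (h ▸ Subgroup.mem_top _)), fun x hx => ?_, hgN⟩
  have h := hom_ext hπ hα (fun g => rfl) x
  rw [MonoidHom.comp_apply, MonoidHom.mem_ker.mp hx, map_one] at h
  exact h.symm

theorem exists_isPrimeSubgroup_le {K : Subgroup (FreeLGroup V G)} (hK : IsPrimeSubgroup K)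
    {g : G} (hg : η V G g ≠ 1) :
    ∃ N : Subgroup (FreeLGroup V G), IsPrimeSubgroup N ∧ N ≤ K ∧ η V G g ∉ N := by
  cases V with
  | all => exact exists_isPrimeSubgroup_le_all hK hg
  | representable =>
    -- Passing to a normal prime below K makes the chain of cosets a totally ordered group.
    obtain ⟨N, hN, _, hNK⟩ := IsRepresentable.exists_normal_le
      (mem_variety (V := Variety.representable)) hK
    obtain ⟨A, _, _, _, _, α, hα, -, rfl⟩ :=
      exists_chain_quotient hN.toIsConvexLSubgroup hN.hasTotalCosets
    obtain ⟨B, _, _, _, _, β, hβ, -, hgβ⟩ := exists_chain_ne hg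
    obtain ⟨P, hP, hPK, hgP⟩ := exists_isPrimeSubgroup_le_ker (V := Variety.representable)
      (isRepresentable_of_linearOrder (A ×ₗ B)) hα hβ (by rwa [map_one] at hgβ)
    exact ⟨P, hP, hPK.trans hNK, hgP⟩
  | abelian =>
    have hcomm : IsAbelian (FreeLGroup Variety.abelian G) := mem_variety (V := Variety.abelian)
    have hnormal : ∀ N : Subgroup (FreeLGroup Variety.abelian G), N.Normal := fun N =>
      ⟨fun x hx y => by rwa [hcomm y x, mul_inv_cancel_right]⟩
    obtain ⟨Q, hQ, hgQ⟩ := exists_isPrimeSubgroup_notMem hg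
    have := hnormal K
    have := hnormal Q
    obtain ⟨A, _, _, _, _, α, hα, hα', rfl⟩ :=
      exists_chain_quotient hK.toIsConvexLSubgroup hK.hasTotalCosets
    obtain ⟨B, _, _, _, _, β, hβ, hβ', rfl⟩ :=
      exists_chain_quotient hQ.toIsConvexLSubgroup hQ.hasTotalCosets
    refine exists_isPrimeSubgroup_le_ker (V := Variety.abelian) (A := A) (B := B) ?_ hα hβ hgQ
    intro x y
    obtain ⟨x₁, h₁⟩ := hα' (ofLex x).1
    obtain ⟨x₂, h₂⟩ := hβ' (ofLex x).2
    obtain ⟨y₁, h₃⟩ := hα' (ofLex y).1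
    obtain ⟨y₂, h₄⟩ := hβ' (ofLex y).2
    refine congrArg toLex (Prod.ext ?_ ?_)
    · change (ofLex x).1 * (ofLex y).1 = (ofLex y).1 * (ofLex x).1
      rw [← h₁, ← h₃, ← map_mul, hcomm, map_mul]
    · change (ofLex x).2 * (ofLex y).2 = (ofLex y).2 * (ofLex x).2
      rw [← h₂, ← h₄, ← map_mul, hcomm, map_mul]

/-- Modulo a prime subgroup, each element of the free ℓ-group agrees with a generator. -/
theorem exists_inv_mul_η_mem {K : Subgroup (FreeLGroup V G)} (hK : IsConvexLSubgroup K)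
    (ht : HasTotalCosets K) (x : FreeLGroup V G) : ∃ g : G, x⁻¹ * η V G g ∈ K := by
  obtain ⟨A, _, ρ, a, hρ, rfl⟩ := exists_chain_action hK ht
  -- The G-orbit of the base point is stable under the free ℓ-group. Arbitrary orbit points are
  -- needed for products, and x⁻¹ is carried along for inverses; joins and meets cause no trouble
  -- because in a chain they select one of two values.
  suffices h : ∀ b ∈ Set.range fun g => ρ (η V G g) a,
      ρ x b ∈ (Set.range fun g => ρ (η V G g) a) ∧
        ρ x⁻¹ b ∈ (Set.range fun g => ρ (η V G g) a) by
    obtain ⟨g, hg⟩ := (h a ⟨1, by simp⟩).1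
    refine ⟨g, ?_⟩
    rw [mem_stabilizer, map_mul, RelIso.mul_apply, show ρ (η V G g) a = ρ x a from hg, map_inv,
      RelIso.inv_apply_self]
  induction x using induction with
  | of g =>
    rintro _ ⟨h, rfl⟩
    exact ⟨⟨g * h, by simp⟩, ⟨g⁻¹ * h, by simp⟩⟩
  | mul x y hx hy =>
    intro b hb
    rw [mul_inv_rev, map_mul, map_mul]
    exact ⟨(hx _ (hy b hb).1).1, (hy _ (hx b hb).2).2⟩
  | inv x hx =>
    intro b hb
    rw [inv_inv]
    exact (hx b hb).symm
  | sup x y hx hy =>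
    intro b hb
    rw [inv_sup, hρ.map_sup, hρ.map_inf, orderIso_sup_apply, orderIso_inf_apply]
    constructor
    · rcases max_choice (ρ x b) (ρ y b) with h | h <;> rw [h]
      exacts [(hx b hb).1, (hy b hb).1]
    · rcases min_choice (ρ x⁻¹ b) (ρ y⁻¹ b) with h | h <;> rw [h]
      exacts [(hx b hb).2, (hy b hb).2]
  | inf x y hx hy =>
    intro b hb
    rw [inv_inf, hρ.map_sup, hρ.map_inf, orderIso_sup_apply, orderIso_inf_apply]
    constructor
    · rcases min_choice (ρ x b) (ρ y b) with h | h <;> rw [h]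
      exacts [(hx b hb).1, (hy b hb).1]
    · rcases max_choice (ρ x⁻¹ b) (ρ y⁻¹ b) with h | h <;> rw [h]
      exacts [(hx b hb).2, (hy b hb).2]

/-- The minimal prime subgroups are those that contain no nontrivial generator. -/
theorem isMin_iff (𝔭 : Spec (FreeLGroup V G)) :
    IsMin 𝔭 ↔ ∀ g, η V G g ∈ 𝔭.1 → η V G g = 1 := by
  constructor
  · intro hmin g hg
    by_contra hne
    obtain ⟨N, hN, hNp, hgN⟩ := exists_isPrimeSubgroup_le 𝔭.2 hne
    exact hgN (hmin (show (⟨N, hN⟩ : Spec _) ≤ 𝔭 from hNp) hg)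
  · intro h 𝔮 hqp x hx
    obtain ⟨g, hg⟩ := exists_inv_mul_η_mem 𝔮.2.toIsConvexLSubgroup 𝔮.2.hasTotalCosets x
    have hg' : η V G g ∈ 𝔭.1 := by simpa using 𝔭.1.mul_mem hx (hqp hg)
    rw [h g hg', mul_one] at hg
    exact inv_mem_iff.mp hg

end FreeLGroup

end LGrp

/-! ### Compactness of the minimal spectrum -/

theorem theorem6p8 (V : LGrp.Variety) (G : Type u) [Group G] [PartialOrder G]
    [MulLeftMono G] [MulRightMono G] :
    CompactSpace (LGrp.MinSpec (LGrp.FreeLGroup V G)) := by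
  refine ⟨isCompact_iff_ultrafilter_le_nhds.mpr fun U _ => ?_⟩
  let K : LGrp.MinSpec (LGrp.FreeLGroup V G) → Subgroup (LGrp.FreeLGroup V G) := fun 𝔭 => 𝔭.1.1
  have hmem : ∀ g, LGrp.FreeLGroup.η V G g ∈ LGrp.ultralimit U K →
      LGrp.FreeLGroup.η V G g = 1 := by
    intro g hg
    obtain ⟨𝔭, hp⟩ := Filter.Eventually.exists (LGrp.mem_ultralimit.mp hg)
    exact (LGrp.FreeLGroup.isMin_iff 𝔭.1).mp 𝔭.2 g hp
  -- If the ultralimit were everything, all generators would be trivial and so would the free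
  -- ℓ-group, which then has no proper subgroup and no prime.
  have hproper : LGrp.ultralimit U K ≠ ⊤ := by
    intro htop
    obtain ⟨𝔭⟩ : Nonempty (LGrp.MinSpec (LGrp.FreeLGroup V G)) := Filter.nonempty_of_neBot ↑U
    refine 𝔭.1.2.proper (eq_top_iff.mpr fun x _ => ?_)
    rw [LGrp.FreeLGroup.eq_one_of_forall_η_eq_one
      (fun g => hmem g (htop ▸ Subgroup.mem_top _)) x]
    exact Subgroup.one_mem _
  let 𝔮 : LGrp.Spec (LGrp.FreeLGroup V G) := ⟨LGrp.ultralimit U K,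
    (LGrp.isConvexLSubgroup_ultralimit U fun 𝔭 => 𝔭.1.2.toIsConvexLSubgroup).isPrimeSubgroup
      (LGrp.hasTotalCosets_ultralimit U fun 𝔭 => 𝔭.1.2.hasTotalCosets) hproper⟩
  refine ⟨⟨𝔮, (LGrp.FreeLGroup.isMin_iff 𝔮).mpr hmem⟩, Set.mem_univ _, le_nhds_iff.mpr ?_⟩
  rintro S hS hopen
  obtain ⟨_, ⟨W, rfl⟩, rfl⟩ := isOpen_induced_iff.mp hopen
  -- One element x of W outside the ultralimit suffices: it is outside 𝔭 for U-almost all 𝔭, which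
  -- places them in the given neighbourhood.
  obtain ⟨x, hxW, hx⟩ := Set.not_subset.mp hS
  have hx' : ∀ᶠ 𝔭 in (U : Filter _), x ∉ K 𝔭 := Ultrafilter.eventually_not.mpr hx
  filter_upwards [hx'] with 𝔭 hp using fun h => hp (h hxW)
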